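/- Let $\Omega\subset\mathbb{R}^2$ be a domain (a non-empty connected open set), not necessarily bounded or smooth, and let $\delta(x)$ denote the distance from $x$ to $\partial\Omega$ (with the convention $1/\delta=0$ if $\partial\Omega=\emptyset$). Let $H_0^1(\Omega)$ be the closure of $C_c^\infty(\Omega)$ in the Sobolev space $H^1(\Omega)$ of real-valued functions in $L^2(\Omega)$ with weak gradient in $L^2(\Omega)$. Suppose that Hardy's inequality holds on $\Omega$, i.e. there is a constant $H$ such that $$\left\|\frac{v}{\delta}\right\|_{L^2(\Omega)}\le H\,\|\nabla v\|_{L^2(\Omega)}\qquad\text{for all } v\in H_0^1(\Omega).$$ Then, for every $u\in H_0^1(\Omega)$, $$\frac{\exp(u^2)-1}{\delta^2}\in L^1(\Omega).$$ In particular, $u^2/\delta^2\in L^1(\Omega)$ and, if $\Omega$ is bounded, $\exp(u^2)-1\in L^1(\Omega)$. -/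

import Mathlib

open MeasureTheory Filter Topology
open scoped ContDiff Gradient ENNReal NNReal

/-- The Euclidean plane. -/
abbrev Plane : Type := EuclideanSpace ℝ (Fin 2)

/-- The distance `δ(x)` from `x` to the boundary `∂Ω`.  If `∂Ω = ∅` this is `0`, so that
`a / δ x = 0` for every `a`, in accordance with the convention `δ = +∞` in that case. -/
noncomputable def bdryDist (Ω : Set Plane) (x : Plane) : ℝ :=
  Metric.infDist x (frontier Ω)

/-- `φ ∈ C_c^∞(Ω)`. -/
structure IsTestFunction (Ω : Set Plane) (φ : Plane → ℝ) : Prop where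
  contDiff : ContDiff ℝ ∞ φ
  hasCompactSupport : HasCompactSupport φ
  tsupport_subset : tsupport φ ⊆ Ω

/-- `g` is a weak (distributional) gradient of `u` on the open set `Ω`. -/
structure HasWeakGradient (Ω : Set Plane) (u : Plane → ℝ) (g : Plane → Plane) : Prop where
  locallyIntegrableOn : LocallyIntegrableOn u Ω
  locallyIntegrableOn_grad : LocallyIntegrableOn g Ω
  integral_eq : ∀ φ : Plane → ℝ, IsTestFunction Ω φ →
    ∫ x in Ω, u x • ∇ φ x = - ∫ x in Ω, φ x • g x

/-- `u ∈ H¹(Ω)`, with weak gradient `g`. -/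
structure IsH1 (Ω : Set Plane) (u : Plane → ℝ) (g : Plane → Plane) : Prop where
  memLp : MemLp u 2 (volume.restrict Ω)
  memLp_grad : MemLp g 2 (volume.restrict Ω)
  hasWeakGradient : HasWeakGradient Ω u g

/-- `u ∈ H₀¹(Ω)`, with weak gradient `g`: `u` belongs to the closure of `C_c^∞(Ω)` in `H¹(Ω)`. -/
structure IsH10 (Ω : Set Plane) (u : Plane → ℝ) (g : Plane → Plane) : Prop where
  isH1 : IsH1 Ω u g
  approx : ∃ φ : ℕ → Plane → ℝ, (∀ n, IsTestFunction Ω (φ n)) ∧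
    Tendsto (fun n => eLpNorm (fun x => u x - φ n x) 2 (volume.restrict Ω)) atTop (𝓝 0) ∧
    Tendsto (fun n => eLpNorm (fun x => g x - ∇ (φ n) x) 2 (volume.restrict Ω)) atTop (𝓝 0)

/-- `u ∈ H₀¹(Ω)`. -/
def MemH10 (Ω : Set Plane) (u : Plane → ℝ) : Prop :=
  ∃ g : Plane → Plane, IsH10 Ω u g

/-- Hardy's inequality holds on `Ω`: there is a constant `H` such that
`‖u/δ‖_{L²(Ω)} ≤ H ‖∇u‖_{L²(Ω)}` for all `u ∈ H₀¹(Ω)`. -/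
def HardyInequality (Ω : Set Plane) : Prop :=
  ∃ H : ℝ≥0, ∀ (u : Plane → ℝ) (g : Plane → Plane), IsH10 Ω u g →
    eLpNorm (fun x => u x / bdryDist Ω x) 2 (volume.restrict Ω)
      ≤ (H : ℝ≥0∞) * eLpNorm g 2 (volume.restrict Ω)

/-! The heart is a Moser-Trudinger inequality for the measure `dμ = dx / d²`, where `d` is a
positive `C¹` function with `|∇d| ≤ 1`, comparable to `δ` on the support of the function at hand.
The embedding of `W^{1,1}` in `L²` of the plane, applied to `v / d`, bounds `∫ v² dμ` by the square
of `∫ |∇v| / d + ∫ |v| dμ`. If `v` lives on a set of small `μ`-measure, Cauchy-Schwarz allows the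
last term to be absorbed (`IsDistanceLike.lintegral_sq_le`).

Taking for `v` a truncation of `f` between two levels bounds the measure of the higher superlevel
set by that of the lower one times the Dirichlet energy in between (`measure_superlevel_le`).
Iterating over many thin layers, whose energies add up to at most the total, gives Gaussian decay by
the AM-GM inequality, at a rate that is as large as desired when the energy is small. Hence `exp (2
f²) - 1` is `μ`-integrable. Hardy's inequality enters through `∫ f² dμ`, which controls both the
measure of `{f > 1}` and the part where `f` is small. No constant depends on `d`.

Finally `u ∈ H₀¹` is a test function `φ` plus a remainder `r` of small energy. Fatou's lemma carries
the bound over to `r`, and `u² ≤ 2φ² + 2r²` with `φ` bounded; hence the factor `2` in the exponents.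
-/

/-! ### Two integral inequalities -/

/-- The **Cauchy-Schwarz inequality** for lower Lebesgue integrals, in squared form. -/
theorem lintegral_mul_sq_le {α : Type*} [MeasurableSpace α] (μ : Measure α) {f g : α → ℝ≥0∞}
    (hf : AEMeasurable f μ) (hg : AEMeasurable g μ) :
    (∫⁻ x, f x * g x ∂μ) ^ 2 ≤ (∫⁻ x, f x ^ 2 ∂μ) * ∫⁻ x, g x ^ 2 ∂μ := by
  have h := ENNReal.lintegral_mul_le_Lp_mul_Lq μ Real.HolderConjugate.two_two hf hg
  simp only [Pi.mul_apply] at h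
  calc (∫⁻ x, f x * g x ∂μ) ^ 2
      ≤ ((∫⁻ x, f x ^ (2 : ℝ) ∂μ) ^ (1 / (2 : ℝ)) * (∫⁻ x, g x ^ (2 : ℝ) ∂μ) ^ (1 / (2 : ℝ))) ^ 2 := by
        gcongr
    _ = _ := by
        rw [mul_pow, ← ENNReal.rpow_mul_natCast, ← ENNReal.rpow_mul_natCast]
        norm_num

/-- The Gagliardo-Nirenberg-Sobolev inequality `‖w‖₂ ≤ C ‖∇w‖₁` in the plane, squared. -/
theorem exists_lintegral_sq_le_sq_lintegral_fderiv :
    ∃ C : ℝ≥0, ∀ w : Plane → ℝ, ContDiff ℝ 1 w → HasCompactSupport w →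
      ∫⁻ x, ‖w x‖ₑ ^ 2 ≤ C * (∫⁻ x, ‖fderiv ℝ w x‖ₑ) ^ 2 := by
  refine ⟨lintegralPowLePowLIntegralFDerivConst (volume : Measure Plane) 2, fun w hw hws => ?_⟩
  have h := lintegral_pow_le_pow_lintegral_fderiv (volume : Measure Plane) hw hws (p := 2)
    (by simpa using Real.HolderConjugate.two_two)
  simpa using h

/-! ### Sobolev inequality for the measure `dx / d²` -/

/-- A positive `C¹` function on the plane whose differential has norm at most one. -/
structure IsDistanceLike (d : Plane → ℝ) : Prop where
  contDiff : ContDiff ℝ 1 d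
  pos : ∀ x, 0 < d x
  norm_fderiv_le : ∀ x, ‖fderiv ℝ d x‖ ≤ 1

/-- The measure `dx / d(x)²`. -/
noncomputable def quasihyperbolicMeasure (d : Plane → ℝ) : Measure Plane :=
  volume.withDensity fun x => ‖(d x)⁻¹‖ₑ ^ 2

namespace IsDistanceLike

variable {d : Plane → ℝ}

theorem contDiff_inv (hd : IsDistanceLike d) : ContDiff ℝ 1 fun x => (d x)⁻¹ :=
  hd.contDiff.inv fun x => (hd.pos x).ne'

theorem measurable_enorm_inv (hd : IsDistanceLike d) : Measurable fun x => ‖(d x)⁻¹‖ₑ :=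
  hd.contDiff_inv.continuous.measurable.enorm

theorem lintegral_eq (hd : IsDistanceLike d) (f : Plane → ℝ≥0∞) :
    ∫⁻ x, f x ∂quasihyperbolicMeasure d = ∫⁻ x, ‖(d x)⁻¹‖ₑ ^ 2 * f x := by
  refine lintegral_withDensity_eq_lintegral_mul_non_measurable _
    (hd.measurable_enorm_inv.pow_const 2) (ae_of_all _ fun x => ?_) f
  simp [enorm_lt_top]

/-- Finiteness is what permits cancelling this integral in the absorption argument. -/
theorem lintegral_sq_lt_top (hd : IsDistanceLike d) {v : Plane → ℝ} (hv : Continuous v)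
    (hvs : HasCompactSupport v) : ∫⁻ x, ‖v x‖ₑ ^ 2 ∂quasihyperbolicMeasure d < ⊤ := by
  rw [hd.lintegral_eq]
  have hc : Continuous fun x => ((d x)⁻¹ * v x) ^ 2 := (hd.contDiff_inv.continuous.mul hv).pow 2
  have hs : HasCompactSupport fun x => ((d x)⁻¹ * v x) ^ 2 := by
    refine hvs.mono fun x hx => ?_
    simp only [Function.mem_support] at hx ⊢
    exact fun h => hx (by simp [h])
  have := (hc.integrable_of_hasCompactSupport (μ := volume) hs).hasFiniteIntegral
  simpa only [HasFiniteIntegral, enorm_pow, enorm_mul, mul_pow] using this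

/-- Product rule, with `|∇(1/d)| ≤ d⁻²` because `|∇d| ≤ 1`. -/
theorem enorm_fderiv_mul_inv_le (hd : IsDistanceLike d) {v : Plane → ℝ} (hv : ContDiff ℝ 1 v)
    (x : Plane) : ‖fderiv ℝ (fun y => v y * (d y)⁻¹) x‖ₑ ≤
      ‖fderiv ℝ v x‖ₑ * ‖(d x)⁻¹‖ₑ + ‖v x‖ₑ * ‖(d x)⁻¹‖ₑ ^ 2 := by
  have hvx : HasFDerivAt v (fderiv ℝ v x) x := (hv.differentiable one_ne_zero x).hasFDerivAt
  have hdx : HasFDerivAt d (fderiv ℝ d x) x :=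
    (hd.contDiff.differentiable one_ne_zero x).hasFDerivAt
  have hi : HasFDerivAt (fun y => (d y)⁻¹) (-((d x) ^ 2)⁻¹ • fderiv ℝ d x) x :=
    (hasDerivAt_inv (hd.pos x).ne').comp_hasFDerivAt x hdx
  have hm : HasFDerivAt (fun y => v y * (d y)⁻¹)
      (v x • -((d x) ^ 2)⁻¹ • fderiv ℝ d x + (d x)⁻¹ • fderiv ℝ v x) x := hvx.mul hi
  rw [hm.fderiv]
  have h1 : ‖fderiv ℝ d x‖ₑ ≤ 1 := by
    rw [← ofReal_norm]
    exact ENNReal.ofReal_le_one.2 (hd.norm_fderiv_le x)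
  calc _ ≤ ‖v x • -((d x) ^ 2)⁻¹ • fderiv ℝ d x‖ₑ + ‖(d x)⁻¹ • fderiv ℝ v x‖ₑ :=
        enorm_add_le (E := Plane →L[ℝ] ℝ) _ _
    _ = ‖v x‖ₑ * (‖(d x)⁻¹‖ₑ ^ 2 * ‖fderiv ℝ d x‖ₑ) + ‖fderiv ℝ v x‖ₑ * ‖(d x)⁻¹‖ₑ := by
        rw [enorm_smul, enorm_smul, enorm_smul, enorm_neg, ← inv_pow, enorm_pow,
          mul_comm ‖(d x)⁻¹‖ₑ]
    _ ≤ ‖v x‖ₑ * (‖(d x)⁻¹‖ₑ ^ 2 * 1) + ‖fderiv ℝ v x‖ₑ * ‖(d x)⁻¹‖ₑ := by gcongr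
    _ = _ := by rw [mul_one, add_comm]

/-- A Sobolev inequality for the quasihyperbolic measure, for functions supported in a set of
small measure. -/
theorem lintegral_sq_le (hd : IsDistanceLike d) {C : ℝ≥0}
    (hC : ∀ w : Plane → ℝ, ContDiff ℝ 1 w → HasCompactSupport w →
      ∫⁻ x, ‖w x‖ₑ ^ 2 ≤ C * (∫⁻ x, ‖fderiv ℝ w x‖ₑ) ^ 2)
    {v : Plane → ℝ} (hv : ContDiff ℝ 1 v) (hvs : HasCompactSupport v) {A : Set Plane}
    (hA : MeasurableSet A) (hvA : ∀ x ∉ A, v x = 0)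
    (hAC : 4 * C * quasihyperbolicMeasure d A ≤ 1) :
    ∫⁻ x, ‖v x‖ₑ ^ 2 ∂quasihyperbolicMeasure d
      ≤ 4 * C * (∫⁻ x, ‖fderiv ℝ v x‖ₑ * ‖(d x)⁻¹‖ₑ) ^ 2 := by
  set μ := quasihyperbolicMeasure d
  set X := ∫⁻ x, ‖v x‖ₑ ^ 2 ∂μ with hX
  set Y := ∫⁻ x, ‖fderiv ℝ v x‖ₑ * ‖(d x)⁻¹‖ₑ with hY
  set Z := ∫⁻ x, ‖v x‖ₑ ∂μ with hZ
  have hXfin : X ≠ ⊤ := (hd.lintegral_sq_lt_top hv.continuous hvs).ne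
  have hvm : Measurable fun x => ‖v x‖ₑ := hv.continuous.measurable.enorm
  have hdm := hd.measurable_enorm_inv
  have hfm : Measurable fun x => ‖fderiv ℝ v x‖ₑ :=
    (hv.continuous_fderiv one_ne_zero).measurable.enorm
  -- Cauchy-Schwarz against the indicator of `A`, off which `v` vanishes.
  have hZ2 : Z ^ 2 ≤ X * μ A := by
    have : Z = ∫⁻ x, ‖v x‖ₑ * A.indicator 1 x ∂μ := by
      refine lintegral_congr fun x => ?_
      by_cases hx : x ∈ A
      · simp [hx]
      · simp [hvA x hx]
    rw [this]
    refine (lintegral_mul_sq_le μ hvm.aemeasurable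
      (measurable_one.indicator hA).aemeasurable).trans_eq ?_
    congr 1
    rw [← lintegral_indicator_one hA]
    refine lintegral_congr fun x => ?_
    by_cases hx : x ∈ A <;> simp [hx]
  have hmain : X ≤ C * (Y + Z) ^ 2 := by
    have hw := hC (fun y => v y * (d y)⁻¹) (hv.mul hd.contDiff_inv) hvs.mul_right
    have h1 : X = ∫⁻ x, ‖v x * (d x)⁻¹‖ₑ ^ 2 := by
      rw [hX, hd.lintegral_eq]
      refine lintegral_congr fun x => ?_
      rw [enorm_mul, mul_pow, mul_comm]
    have h2 : ∫⁻ x, ‖fderiv ℝ (fun y => v y * (d y)⁻¹) x‖ₑ ≤ Y + Z := by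
      rw [hZ, hd.lintegral_eq, hY, ← lintegral_add_left (by fun_prop)]
      refine lintegral_mono fun x => (hd.enorm_fderiv_mul_inv_le hv x).trans_eq ?_
      rw [mul_comm ‖v x‖ₑ]
    rw [h1]
    exact hw.trans (by gcongr)
  have hsq : (Y + Z) ^ 2 ≤ 2 * Y ^ 2 + 2 * Z ^ 2 := by
    rw [← mul_add]
    have := ENNReal.rpow_add_le_mul_rpow_add_rpow Y Z (p := 2) (by norm_num)
    norm_num at this
    exact_mod_cast this
  -- Absorption: smallness of `μ A` makes the coefficient of `X` on the right at most one, and one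
  -- copy of `X` cancels.
  have h2X : 2 * X ≤ 4 * C * Y ^ 2 + X := by
    calc 2 * X ≤ 2 * (C * (2 * Y ^ 2 + 2 * (X * μ A))) := by
          gcongr
          exact hmain.trans (by gcongr; exact hsq.trans (by gcongr))
      _ = 4 * C * Y ^ 2 + (4 * C * μ A) * X := by ring
      _ ≤ 4 * C * Y ^ 2 + 1 * X := by gcongr
      _ = _ := by rw [one_mul]
  rw [two_mul] at h2X
  exact (ENNReal.add_le_add_iff_right hXfin).1 h2X

end IsDistanceLike

/-! ### Truncation and decay across one level step -/

/-- Such a point is a global minimum or maximum. The endpoints are included, so the gradient of a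
truncation lives on an open layer, and consecutive layers are disjoint. -/
theorem deriv_smoothTransition_eq_zero {t : ℝ} (ht : t ∉ Set.Ioo (0 : ℝ) 1) :
    deriv Real.smoothTransition t = 0 := by
  rw [Set.mem_Ioo, not_and_or, not_lt, not_lt] at ht
  rcases ht with ht | ht
  · refine IsLocalMin.deriv_eq_zero (Eventually.of_forall fun s => ?_)
    rw [Real.smoothTransition.zero_of_nonpos ht]
    exact Real.smoothTransition.nonneg s
  · refine IsLocalMax.deriv_eq_zero (Eventually.of_forall fun s => ?_)
    rw [Real.smoothTransition.one_of_one_le ht]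
    exact Real.smoothTransition.le_one s

theorem exists_enorm_deriv_smoothTransition_le :
    ∃ L : ℝ≥0, ∀ t, ‖deriv Real.smoothTransition t‖ₑ ≤ L := by
  have hc : Continuous (deriv Real.smoothTransition) :=
    (Real.smoothTransition.contDiff (n := 1)).continuous_deriv le_rfl
  obtain ⟨L, hL⟩ := (isCompact_Icc (a := (0 : ℝ)) (b := 1)).exists_bound_of_continuousOn
    hc.continuousOn
  refine ⟨L.toNNReal, fun t => ?_⟩
  by_cases ht : t ∈ Set.Ioo (0 : ℝ) 1
  · rw [← ofReal_norm]
    exact ENNReal.ofReal_le_ofReal (hL t (Set.Ioo_subset_Icc_self ht))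
  · simp [deriv_smoothTransition_eq_zero ht]

namespace IsDistanceLike

variable {d : Plane → ℝ}

/-- The decay of the measure of superlevel sets over one level step. -/
theorem measure_superlevel_le (hd : IsDistanceLike d) {C L : ℝ≥0}
    (hC : ∀ w : Plane → ℝ, ContDiff ℝ 1 w → HasCompactSupport w →
      ∫⁻ x, ‖w x‖ₑ ^ 2 ≤ C * (∫⁻ x, ‖fderiv ℝ w x‖ₑ) ^ 2)
    (hL : ∀ t, ‖deriv Real.smoothTransition t‖ₑ ≤ L)
    {f : Plane → ℝ} (hf : ContDiff ℝ 1 f) (hfs : HasCompactSupport f) {a h : ℝ} (ha : 0 ≤ a)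
    (hh : 0 < h) (haC : 4 * C * quasihyperbolicMeasure d {x | a < f x} ≤ 1) :
    quasihyperbolicMeasure d {x | a + h < f x} ≤
      4 * C * L ^ 2 * ENNReal.ofReal (h⁻¹) ^ 2 *
        (∫⁻ x in {x | a < f x ∧ f x < a + h}, ‖fderiv ℝ f x‖ₑ ^ 2) *
        quasihyperbolicMeasure d {x | a < f x} := by
  set μ := quasihyperbolicMeasure d with hμ
  set g : ℝ → ℝ := fun s => h⁻¹ * (s - a) with hg
  -- A smooth truncation of `f`: `0` where `f ≤ a`, `1` where `f ≥ a + h`.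
  set v : Plane → ℝ := fun x => Real.smoothTransition (g (f x)) with hv
  have hgc : ContDiff ℝ 1 fun x => g (f x) := contDiff_const.mul (hf.sub contDiff_const)
  have hvc : ContDiff ℝ 1 v := Real.smoothTransition.contDiff.comp hgc
  have hfm : Measurable f := hf.continuous.measurable
  have hA : MeasurableSet {x | a < f x} := measurableSet_lt measurable_const hfm
  have hS : MeasurableSet {x | a < f x ∧ f x < a + h} :=
    hA.inter (measurableSet_lt hfm measurable_const)
  have hvA : ∀ x ∉ {x | a < f x}, v x = 0 := fun x hx => by
    refine Real.smoothTransition.zero_of_nonpos (mul_nonpos_of_nonneg_of_nonpos (by positivity) ?_)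
    simpa using hx
  have hvs : HasCompactSupport v := by
    refine hfs.mono fun x hx => ?_
    by_contra hfx
    rw [Function.notMem_support] at hfx
    exact hx (hvA x (by simp [hfx, ha]))
  have hone : ∀ x ∈ {x | a + h < f x}, v x = 1 := fun x hx => by
    refine Real.smoothTransition.one_of_one_le ?_
    simp only [Set.mem_ofPred_eq] at hx
    rw [hg]
    field_simp
    linarith
  have hfd : ∀ x, ‖fderiv ℝ v x‖ₑ ≤ {x | a < f x ∧ f x < a + h}.indicator
      (fun x => L * ENNReal.ofReal h⁻¹ * ‖fderiv ℝ f x‖ₑ) x := by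
    intro x
    have hfx : HasFDerivAt f (fderiv ℝ f x) x := (hf.differentiable one_ne_zero x).hasFDerivAt
    have hgx : HasFDerivAt (fun x => g (f x)) (h⁻¹ • fderiv ℝ f x) x :=
      (hfx.sub_const a).const_mul h⁻¹
    have hSx : HasDerivAt Real.smoothTransition (deriv Real.smoothTransition (g (f x))) (g (f x)) :=
      (Real.smoothTransition.contDiff.differentiable one_ne_zero _).hasDerivAt
    have hvx : HasFDerivAt v (deriv Real.smoothTransition (g (f x)) • h⁻¹ • fderiv ℝ f x) x :=
      HasDerivAt.comp_hasFDerivAt (f := fun x => g (f x)) x hSx hgx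
    rw [hvx.fderiv]
    by_cases hx : x ∈ {x | a < f x ∧ f x < a + h}
    · rw [Set.indicator_of_mem hx, enorm_smul, enorm_smul, ← mul_assoc,
        Real.enorm_of_nonneg (by positivity : 0 ≤ h⁻¹)]
      gcongr
      exact hL _
    · rw [deriv_smoothTransition_eq_zero, zero_smul]
      · rw [← ofReal_norm, norm_zero, ENNReal.ofReal_zero]
        exact zero_le
      · rintro ⟨h0, h1⟩
        refine hx ⟨?_, ?_⟩
        · have := (mul_pos_iff_of_pos_left (inv_pos.2 hh)).1 h0
          linarith
        · have : h * (h⁻¹ * (f x - a)) < h * 1 := by gcongr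
          rw [mul_inv_cancel_left₀ hh.ne'] at this
          linarith
  have hmeas : μ {x | a + h < f x} ≤ ∫⁻ x, ‖v x‖ₑ ^ 2 ∂μ := by
    rw [← lintegral_indicator_one (measurableSet_lt measurable_const hfm)]
    refine lintegral_mono fun x => ?_
    by_cases hx : x ∈ {x | a + h < f x}
    · simp [Set.indicator_of_mem hx, hone x hx]
    · simp [Set.indicator_of_notMem hx]
  have hfdm : Measurable fun x => ‖fderiv ℝ f x‖ₑ :=
    (hf.continuous_fderiv one_ne_zero).measurable.enorm
  have hY : (∫⁻ x, ‖fderiv ℝ v x‖ₑ * ‖(d x)⁻¹‖ₑ) ^ 2 ≤ (L * ENNReal.ofReal h⁻¹) ^ 2 *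
      ((∫⁻ x in {x | a < f x ∧ f x < a + h}, ‖fderiv ℝ f x‖ₑ ^ 2) * μ {x | a < f x}) := by
    calc (∫⁻ x, ‖fderiv ℝ v x‖ₑ * ‖(d x)⁻¹‖ₑ) ^ 2
        ≤ (L * ENNReal.ofReal h⁻¹ *
          ∫⁻ x in {x | a < f x ∧ f x < a + h}, ‖fderiv ℝ f x‖ₑ * ‖(d x)⁻¹‖ₑ) ^ 2 := by
          gcongr
          have hdm := hd.measurable_enorm_inv
          rw [← lintegral_const_mul _ (by fun_prop), ← lintegral_indicator hS]
          refine lintegral_mono fun x => ?_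
          refine (mul_le_mul_left (hfd x) _).trans_eq ?_
          by_cases hx : x ∈ {x | a < f x ∧ f x < a + h}
          · simp only [Set.indicator_of_mem hx, mul_assoc]
          · simp [Set.indicator_of_notMem hx]
      _ ≤ _ := by
          rw [mul_pow]
          gcongr
          -- Cauchy-Schwarz on the layer; the integral of `d⁻²` there is at most `μ {a < f}`.
          refine (lintegral_mul_sq_le _ hfdm.aemeasurable
            hd.measurable_enorm_inv.aemeasurable).trans ?_
          gcongr
          rw [hμ, quasihyperbolicMeasure, withDensity_apply _ hA]
          exact lintegral_mono_set fun x hx => hx.1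
  refine hmeas.trans ((hd.lintegral_sq_le hC hvc hvs hA hvA haC).trans ?_)
  refine (mul_le_mul_right hY _).trans_eq ?_
  ring

end IsDistanceLike

/-! ### Iteration over thin layers -/

/-- The inequality of arithmetic and geometric means for extended nonnegative reals. -/
theorem ENNReal.prod_le_pow_of_sum_le {n : ℕ} {e : ℕ → ℝ≥0∞} {B : ℝ≥0∞}
    (h : ∑ i ∈ Finset.range n, e i ≤ n * B) : ∏ i ∈ Finset.range n, e i ≤ B ^ n := by
  rcases Nat.eq_zero_or_pos n with rfl | hn
  · simp
  rcases eq_or_ne B ⊤ with rfl | hB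
  · rw [ENNReal.top_pow hn.ne']
    exact le_top
  have hfin : ∀ i ∈ Finset.range n, e i ≠ ⊤ := fun i hi =>
    ((Finset.single_le_sum (fun _ _ => zero_le) hi).trans h).trans_lt
      (ENNReal.mul_lt_top (ENNReal.natCast_lt_top n) hB.lt_top) |>.ne
  have hcoe : ∀ i ∈ Finset.range n, e i = ENNReal.ofReal (e i).toReal := fun i hi =>
    (ENNReal.ofReal_toReal (hfin i hi)).symm
  have hB' : B = ENNReal.ofReal B.toReal := (ENNReal.ofReal_toReal hB).symm
  have hn' : (0 : ℝ) < n := Nat.cast_pos.2 hn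
  have hsum : ∑ i ∈ Finset.range n, (e i).toReal ≤ n * B.toReal := by
    rw [← ENNReal.toReal_sum hfin, ← ENNReal.toReal_natCast, ← ENNReal.toReal_mul]
    exact ENNReal.toReal_mono (ENNReal.mul_ne_top (ENNReal.natCast_ne_top n) hB) h
  have hP : 0 ≤ ∏ i ∈ Finset.range n, (e i).toReal :=
    Finset.prod_nonneg fun i _ => ENNReal.toReal_nonneg
  have hgm := Real.geom_mean_le_arith_mean (Finset.range n) (fun _ => 1) (fun i => (e i).toReal)
    (by simp) (by simpa using hn) (by simp)
  simp only [Real.rpow_one, one_mul, Finset.sum_const, Finset.card_range, nsmul_eq_mul,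
    mul_one] at hgm
  have hle : (∏ i ∈ Finset.range n, (e i).toReal) ^ ((n : ℝ)⁻¹) ≤ B.toReal :=
    hgm.trans ((div_le_iff₀' hn').2 hsum)
  rw [Finset.prod_congr rfl hcoe, ← ENNReal.ofReal_prod_of_nonneg (by simp), hB',
    ← ENNReal.ofReal_pow (by simp)]
  refine ENNReal.ofReal_le_ofReal ?_
  calc _ = ((∏ i ∈ Finset.range n, (e i).toReal) ^ ((n : ℝ)⁻¹)) ^ n :=
        (Real.rpow_inv_natCast_pow hP hn.ne').symm
    _ ≤ _ := by gcongr

namespace IsDistanceLike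

variable {d : Plane → ℝ}

/-- Superexponential decay of the measure of superlevel sets. -/
theorem measure_superlevel_le_pow (hd : IsDistanceLike d) {C L : ℝ≥0}
    (hC : ∀ w : Plane → ℝ, ContDiff ℝ 1 w → HasCompactSupport w →
      ∫⁻ x, ‖w x‖ₑ ^ 2 ≤ C * (∫⁻ x, ‖fderiv ℝ w x‖ₑ) ^ 2)
    (hL : ∀ t, ‖deriv Real.smoothTransition t‖ₑ ≤ L)
    {f : Plane → ℝ} (hf : ContDiff ℝ 1 f) (hfs : HasCompactSupport f)
    (hfC : 4 * C * quasihyperbolicMeasure d {x | 1 < f x} ≤ 1) {N : ℕ} (hN : 0 < N) (s : ℕ) :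
    quasihyperbolicMeasure d {x | 1 + s < f x} ≤
      (4 * C * L ^ 2 * N * ∫⁻ x, ‖fderiv ℝ f x‖ₑ ^ 2) ^ (N * s ^ 2) *
        quasihyperbolicMeasure d {x | 1 < f x} := by
  rcases Nat.eq_zero_or_pos s with rfl | hs
  · simp
  set μ := quasihyperbolicMeasure d with hμ
  have hN' : (0 : ℝ) < N := Nat.cast_pos.2 hN
  have hs' : (0 : ℝ) < s := Nat.cast_pos.2 hs
  -- With this height, `N s²` layers climb exactly `s`. The factor `h⁻² = N² s²` against a mean
  -- layer energy of at most the total over `N s²` leaves just `N` times the total energy.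
  set h : ℝ := ((N : ℝ) * s)⁻¹ with hh
  have hpos : 0 < h := by positivity
  set S : ℕ → Set Plane := fun i => {x | 1 + i * h < f x ∧ f x < 1 + i * h + h} with hS
  set E : ℕ → ℝ≥0∞ := fun i => ∫⁻ x in S i, ‖fderiv ℝ f x‖ₑ ^ 2 with hE
  have hfm : Measurable f := hf.continuous.measurable
  have hiter : ∀ i : ℕ, μ {x | 1 + i * h < f x} ≤
      (∏ j ∈ Finset.range i, 4 * C * L ^ 2 * ENNReal.ofReal h⁻¹ ^ 2 * E j) * μ {x | 1 < f x} := by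
    intro i
    induction i with
    | zero => simp
    | succ i ih =>
      have h0 : 0 ≤ i * h := by positivity
      have hsub : {x | 1 + i * h < f x} ⊆ {x | 1 < f x} := by
        intro x hx
        rw [Set.mem_ofPred_eq] at hx ⊢
        linarith
      have hstep := hd.measure_superlevel_le hC hL hf hfs (a := 1 + i * h) (by linarith) hpos
        (le_trans (by gcongr) hfC)
      have heq : (1 : ℝ) + ((i + 1 : ℕ) : ℝ) * h = 1 + i * h + h := by push_cast; ring
      rw [heq, Finset.prod_range_succ]
      refine hstep.trans ((mul_le_mul_right ih _).trans_eq ?_)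
      simp only [hE, hS]
      ring
  have hdisj : Pairwise (Function.onFun Disjoint S) := by
    intro i j hij
    rw [Function.onFun, Set.disjoint_left]
    rintro x ⟨h1, h2⟩ ⟨h3, h4⟩
    rcases lt_or_gt_of_ne hij with hlt | hlt
    · have : ((i : ℝ) + 1) * h ≤ j * h := by gcongr; exact_mod_cast hlt
      linarith
    · have : ((j : ℝ) + 1) * h ≤ i * h := by gcongr; exact_mod_cast hlt
      linarith
  have hsumE : ∀ n, ∑ j ∈ Finset.range n, E j ≤ ∫⁻ x, ‖fderiv ℝ f x‖ₑ ^ 2 := by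
    intro n
    rw [← lintegral_biUnion_finset (fun i _ j _ hij => hdisj hij) fun i _ =>
      (measurableSet_lt measurable_const hfm).inter (measurableSet_lt hfm measurable_const)]
    exact setLIntegral_le_lintegral _ _
  have hinv : ENNReal.ofReal h⁻¹ = N * s := by
    rw [hh, inv_inv, ENNReal.ofReal_mul hN'.le, ENNReal.ofReal_natCast, ENNReal.ofReal_natCast]
  have hfinal := hiter (N * s ^ 2)
  have heq : (1 : ℝ) + ((N * s ^ 2 : ℕ) : ℝ) * h = 1 + s := by
    rw [hh]; push_cast; field_simp
  rw [heq] at hfinal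
  refine hfinal.trans ?_
  gcongr
  refine ENNReal.prod_le_pow_of_sum_le ?_
  rw [← Finset.mul_sum, hinv]
  refine (mul_le_mul_right (hsumE _) _).trans_eq ?_
  push_cast
  ring

/-! ### Exponential integrability for the measure `dx / d²` -/

/-- On `k + 1 < f ≤ k + 2` with `k ≥ 1` the exponent satisfies `2 f² ≤ 2 (3k)² = 18 k²`. The decay
`exp (-19 k²)` obtained with `N = 19` beats this and leaves a geometric series. -/
theorem lintegral_exp_superlevel_le (hd : IsDistanceLike d) {C L : ℝ≥0}
    (hC : ∀ w : Plane → ℝ, ContDiff ℝ 1 w → HasCompactSupport w →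
      ∫⁻ x, ‖w x‖ₑ ^ 2 ≤ C * (∫⁻ x, ‖fderiv ℝ w x‖ₑ) ^ 2)
    (hL : ∀ t, ‖deriv Real.smoothTransition t‖ₑ ≤ L)
    {f : Plane → ℝ} (hf : ContDiff ℝ 1 f) (hfs : HasCompactSupport f)
    (hfC : 4 * C * quasihyperbolicMeasure d {x | 1 < f x} ≤ 1)
    (hfE : 4 * C * L ^ 2 * (19 : ℕ) * ∫⁻ x, ‖fderiv ℝ f x‖ₑ ^ 2 ≤ ENNReal.ofReal (Real.exp (-1))) :
    ∫⁻ x in {x | 2 < f x}, ENNReal.ofReal (Real.exp (2 * f x ^ 2) - 1) ∂quasihyperbolicMeasure d ≤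
      (1 - ENNReal.ofReal (Real.exp (-1)))⁻¹ * quasihyperbolicMeasure d {x | 1 < f x} := by
  set μ := quasihyperbolicMeasure d with hμ
  have hfm : Measurable f := hf.continuous.measurable
  have hms : ∀ t : ℝ, MeasurableSet {x | t < f x} := fun t => measurableSet_lt measurable_const hfm
  rw [← lintegral_indicator (hms 2)]
  have hpt : ∀ x, {x | 2 < f x}.indicator
      (fun x => ENNReal.ofReal (Real.exp (2 * f x ^ 2) - 1)) x ≤
      ∑' k : ℕ, ENNReal.ofReal (Real.exp (18 * k ^ 2)) *
        {x | 1 + (k : ℝ) < f x}.indicator 1 x := by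
    intro x
    by_cases hx : 2 < f x
    · rw [Set.indicator_of_mem (by exact hx)]
      have hc2 : 2 < ⌈f x⌉₊ := Nat.lt_ceil.2 (by exact_mod_cast hx)
      obtain ⟨k, hk⟩ : ∃ k, ⌈f x⌉₊ = k + 2 := ⟨⌈f x⌉₊ - 2, by omega⟩
      have hk1 : (1 : ℝ) ≤ k := by exact_mod_cast (by omega : 1 ≤ k)
      have hlow : 1 + (k : ℝ) < f x := by
        have := Nat.lt_ceil.1 (by omega : k + 1 < ⌈f x⌉₊)
        push_cast at this
        linarith
      have hup : f x ≤ k + 2 := by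
        have := Nat.le_ceil (f x)
        rw [hk] at this
        exact_mod_cast this
      refine le_trans ?_ (ENNReal.le_tsum k)
      rw [Set.indicator_of_mem (by exact hlow), Pi.one_apply, mul_one]
      refine ENNReal.ofReal_le_ofReal ((sub_le_self _ zero_le_one).trans (Real.exp_le_exp.2 ?_))
      nlinarith
    · rw [Set.indicator_of_notMem (by exact hx)]
      exact zero_le
  refine (lintegral_mono hpt).trans ?_
  rw [lintegral_tsum fun k => ((measurable_one.indicator (hms _)).const_mul _).aemeasurable,
    ← ENNReal.tsum_geometric, ← ENNReal.tsum_mul_right]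
  refine ENNReal.tsum_le_tsum fun k => ?_
  rw [lintegral_const_mul _ (measurable_one.indicator (hms _)), lintegral_indicator_one (hms _)]
  have hdec := hd.measure_superlevel_le_pow hC hL hf hfs hfC (N := 19) (by norm_num) k
  calc _ ≤ ENNReal.ofReal (Real.exp (18 * k ^ 2)) *
        (ENNReal.ofReal (Real.exp (-1)) ^ (19 * k ^ 2) * μ {x | 1 < f x}) := by
        gcongr
        exact hdec.trans (by gcongr)
    _ ≤ _ := by
        rw [← mul_assoc]
        gcongr
        rw [← ENNReal.ofReal_pow (Real.exp_nonneg _), ← ENNReal.ofReal_pow (Real.exp_nonneg _),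
          ← ENNReal.ofReal_mul (Real.exp_nonneg _), ← Real.exp_nat_mul, ← Real.exp_nat_mul,
          ← Real.exp_add]
        refine ENNReal.ofReal_le_ofReal (Real.exp_le_exp.2 ?_)
        have : (k : ℝ) ≤ k ^ 2 := by exact_mod_cast Nat.le_self_pow two_ne_zero k
        push_cast
        linarith

/-- A Moser-Trudinger inequality for the quasihyperbolic measure. -/
theorem lintegral_exp_sq_le (hd : IsDistanceLike d) {C L : ℝ≥0}
    (hC : ∀ w : Plane → ℝ, ContDiff ℝ 1 w → HasCompactSupport w →
      ∫⁻ x, ‖w x‖ₑ ^ 2 ≤ C * (∫⁻ x, ‖fderiv ℝ w x‖ₑ) ^ 2)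
    (hL : ∀ t, ‖deriv Real.smoothTransition t‖ₑ ≤ L)
    {f : Plane → ℝ} (hf : ContDiff ℝ 1 f) (hfs : HasCompactSupport f)
    (hfC : 4 * C * ∫⁻ x, ‖f x‖ₑ ^ 2 ∂quasihyperbolicMeasure d ≤ 1)
    (hfE : 4 * C * L ^ 2 * (19 : ℕ) * ∫⁻ x, ‖fderiv ℝ f x‖ₑ ^ 2 ≤ ENNReal.ofReal (Real.exp (-1))) :
    ∫⁻ x, ENNReal.ofReal (Real.exp (2 * f x ^ 2) - 1) ∂quasihyperbolicMeasure d ≤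
      (ENNReal.ofReal (2 * Real.exp 8) + 2 * (1 - ENNReal.ofReal (Real.exp (-1)))⁻¹) *
        ∫⁻ x, ‖f x‖ₑ ^ 2 ∂quasihyperbolicMeasure d := by
  set μ := quasihyperbolicMeasure d with hμ
  set c := (1 - ENNReal.ofReal (Real.exp (-1)))⁻¹
  -- Used for `g = f` and `g = -f`; the measure of `{1 < g}` is bounded by Chebyshev's inequality.
  have hhalf : ∀ g : Plane → ℝ, ContDiff ℝ 1 g → HasCompactSupport g →
      (∀ x, ‖g x‖ₑ = ‖f x‖ₑ) → (∀ x, ‖fderiv ℝ g x‖ₑ = ‖fderiv ℝ f x‖ₑ) →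
      ∫⁻ x in {x | 2 < g x}, ENNReal.ofReal (Real.exp (2 * g x ^ 2) - 1) ∂μ ≤
        c * ∫⁻ x, ‖f x‖ₑ ^ 2 ∂μ := by
    intro g hg hgs hgf hgd
    have hm : μ {x | 1 < g x} ≤ ∫⁻ x, ‖f x‖ₑ ^ 2 ∂μ := by
      rw [← lintegral_indicator_one
        (measurableSet_lt measurable_const hg.continuous.measurable)]
      refine lintegral_mono (Set.indicator_le fun y hy => ?_)
      rw [← hgf y, Pi.one_apply]
      refine one_le_pow₀ ?_
      rw [← ofReal_norm, ← ENNReal.ofReal_one]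
      exact ENNReal.ofReal_le_ofReal ((le_of_lt hy).trans (Real.le_norm_self _))
    refine (hd.lintegral_exp_superlevel_le hC hL hg hgs (le_trans (by gcongr) hfC) ?_).trans
      (by gcongr)
    simpa only [hgd] using hfE
  have h1 := hhalf f hf hfs (fun _ => rfl) fun _ => rfl
  have h2 := hhalf (fun x => -f x) hf.neg hfs.neg (fun _ => enorm_neg _) fun x => by
    rw [fderiv_fun_neg, ← ofReal_norm, norm_neg, ofReal_norm]
  simp only [neg_sq] at h2
  have hfm : Measurable f := hf.continuous.measurable
  have hms : MeasurableSet {x | 2 < f x} := measurableSet_lt measurable_const hfm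
  have hms' : MeasurableSet {x | 2 < -f x} := measurableSet_lt measurable_const hfm.neg
  set F : Plane → ℝ≥0∞ := fun x => ENNReal.ofReal (Real.exp (2 * f x ^ 2) - 1) with hF
  have hFm : Measurable F := by fun_prop
  have hpt : ∀ x, F x ≤ ENNReal.ofReal (2 * Real.exp 8) * ‖f x‖ₑ ^ 2 +
      ({x | 2 < f x}.indicator F x + {x | 2 < -f x}.indicator F x) := by
    intro x
    by_cases hx : 2 < f x
    · rw [Set.indicator_of_mem (by exact hx)]
      exact le_add_left (le_add_right le_rfl)
    by_cases hx' : 2 < -f x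
    · rw [Set.indicator_of_mem (s := {x | 2 < -f x}) (by exact hx')]
      exact le_add_left (le_add_left le_rfl)
    -- Where `|f| ≤ 2`, put `t = 2 f² ≤ 8` in `exp t - 1 ≤ t exp t`.
    refine le_add_right ?_
    rw [← ofReal_norm, ← ENNReal.ofReal_pow (norm_nonneg _),
      ← ENNReal.ofReal_mul (by positivity), Real.norm_eq_abs, sq_abs]
    refine ENNReal.ofReal_le_ofReal ?_
    have hsq : f x ^ 2 ≤ 4 := by nlinarith
    have hexp : Real.exp (2 * f x ^ 2) ≤ Real.exp 8 := Real.exp_le_exp.2 (by linarith)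
    have hneg := Real.one_sub_le_exp_neg (2 * f x ^ 2)
    have hmul : Real.exp (2 * f x ^ 2) * Real.exp (-(2 * f x ^ 2)) = 1 := by
      rw [← Real.exp_add, add_neg_cancel, Real.exp_zero]
    nlinarith [Real.exp_pos (2 * f x ^ 2), sq_nonneg (f x),
      mul_le_mul_of_nonneg_left hneg (Real.exp_pos (2 * f x ^ 2)).le,
      mul_le_mul_of_nonneg_right hexp (sq_nonneg (f x))]
  refine (lintegral_mono hpt).trans ?_
  rw [lintegral_add_left (by fun_prop),
    lintegral_add_right _ (hFm.indicator hms'), lintegral_indicator hms, lintegral_indicator hms',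
    lintegral_const_mul _ (hfm.enorm.pow_const 2), add_mul, two_mul c, add_mul]
  gcongr

end IsDistanceLike

/-! ### Regularized distance -/

/-- Smooth regularization of a nonnegative `1`-Lipschitz function, comparable to it on a given
compact set on which it is positive. -/
theorem LipschitzWith.exists_isDistanceLike {δ : Plane → ℝ} (hδ : LipschitzWith 1 δ)
    (hδ0 : ∀ x, 0 ≤ δ x) {K : Set Plane} (hK : IsCompact K) (hKδ : ∀ x ∈ K, 0 < δ x) :
    ∃ d : Plane → ℝ, IsDistanceLike d ∧ ∀ x ∈ K, δ x ≤ d x ∧ d x ≤ 2 * δ x := by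
  obtain ⟨m, hm, hmK⟩ := hK.exists_forall_le' hδ.continuous.continuousOn hKδ
  -- Mollifying at radius `m / 4` moves `δ` by at most `m / 4`. After adding `m / 2` the excess over
  -- `δ` lies in `[m/4, 3m/4]`: the result is positive everywhere, and at most `2 δ` on `K`, where
  -- `δ ≥ m`.
  let φ : ContDiffBump (0 : Plane) := ⟨m / 8, m / 4, by positivity, by linarith⟩
  let c : Plane → ℝ := convolution (φ.normed volume) δ (ContinuousLinearMap.lsmul ℝ ℝ) volume
  have hc1 : ContDiff ℝ 1 c := φ.hasCompactSupport_normed.contDiff_convolution_left (n := 1) _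
    φ.contDiff_normed hδ.continuous.locallyIntegrable
  have hclose : ∀ x, |c x - δ x| ≤ m / 4 := fun x => by
    rw [← Real.dist_eq]
    refine φ.dist_normed_convolution_le hδ.continuous.aestronglyMeasurable fun y hy => ?_
    have := hδ.dist_le_mul y x
    rw [NNReal.coe_one, one_mul] at this
    exact this.trans (Metric.mem_ball.1 hy).le
  have hint : ∀ x, Integrable fun t => φ.normed volume t * δ (x - t) := fun x =>
    (φ.continuous_normed.mul
      (hδ.continuous.comp (continuous_const.sub continuous_id))).integrable_of_hasCompactSupport
        φ.hasCompactSupport_normed.mul_right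
  have hcL : LipschitzWith 1 c := by
    refine LipschitzWith.of_dist_le_mul fun x y => ?_
    rw [NNReal.coe_one, one_mul, Real.dist_eq]
    have hcx : ∀ x, c x = ∫ t, φ.normed volume t * δ (x - t) := fun x => rfl
    have hφi : Integrable fun t => φ.normed volume t * dist x y :=
      φ.integrable_normed.mul_const _
    rw [hcx, hcx, ← integral_sub (hint x) (hint y), ← Real.norm_eq_abs]
    refine (norm_integral_le_of_norm_le hφi (ae_of_all _ fun t => ?_)).trans_eq ?_
    · rw [← mul_sub, norm_mul, Real.norm_of_nonneg (φ.nonneg_normed t), ← dist_eq_norm]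
      refine mul_le_mul_of_nonneg_left ?_ (φ.nonneg_normed t)
      have := hδ.dist_le_mul (x - t) (y - t)
      rwa [NNReal.coe_one, one_mul, dist_sub_right] at this
    · rw [integral_mul_const, φ.integral_normed, one_mul]
  refine ⟨fun x => c x + m / 2, ⟨hc1.add contDiff_const, fun x => ?_, fun x => ?_⟩, fun x hx => ?_⟩
  · have := abs_le.1 (hclose x)
    have := hδ0 x
    linarith
  · rw [fderiv_add_const]
    simpa using norm_fderiv_le_of_lipschitz ℝ hcL
  · have := abs_le.1 (hclose x)
    have := hmK x hx
    constructor <;> linarith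

/-! ### Test functions as elements of `H₀¹` -/

theorem norm_gradient_eq_norm_fderiv {f : Plane → ℝ} (x : Plane) : ‖∇ f x‖ = ‖fderiv ℝ f x‖ :=
  LinearIsometryEquiv.norm_map _ _

theorem enorm_gradient_eq_enorm_fderiv {f : Plane → ℝ} (x : Plane) :
    ‖∇ f x‖ₑ = ‖fderiv ℝ f x‖ₑ := by
  rw [← ofReal_norm, norm_gradient_eq_norm_fderiv, ofReal_norm]

theorem inner_gradient_eq_fderiv {f : Plane → ℝ} (x v : Plane) :
    inner ℝ v (∇ f x) = fderiv ℝ f x v := by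
  rw [real_inner_comm, gradient, InnerProductSpace.toDual_symm_apply]

namespace IsTestFunction

variable {Ω : Set Plane} {φ ψ : Plane → ℝ}

theorem continuous (hφ : IsTestFunction Ω φ) : Continuous φ := hφ.contDiff.continuous

theorem contDiff_one (hφ : IsTestFunction Ω φ) : ContDiff ℝ 1 φ := hφ.contDiff.of_le (by simp)

theorem differentiable (hφ : IsTestFunction Ω φ) : Differentiable ℝ φ :=
  hφ.contDiff_one.differentiable one_ne_zero

theorem continuous_gradient (hφ : IsTestFunction Ω φ) : Continuous (∇ φ) :=
  (InnerProductSpace.toDual ℝ Plane).symm.continuous.comp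
    (hφ.contDiff_one.continuous_fderiv one_ne_zero)

theorem gradient_eq_zero_of_notMem (hφ : IsTestFunction Ω φ) {x : Plane} (hx : x ∉ Ω) :
    ∇ φ x = 0 := by
  have : fderiv ℝ φ x = 0 := by
    by_contra h
    exact hx (hφ.tsupport_subset (support_fderiv_subset ℝ h))
  rw [gradient, this, map_zero]

theorem eq_zero_of_notMem (hφ : IsTestFunction Ω φ) {x : Plane} (hx : x ∉ Ω) : φ x = 0 := by
  by_contra h
  exact hx (hφ.tsupport_subset (subset_tsupport φ h))

theorem hasCompactSupport_gradient (hφ : IsTestFunction Ω φ) : HasCompactSupport (∇ φ) :=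
  (hφ.hasCompactSupport.fderiv ℝ).comp_left (map_zero _)

theorem sub (hφ : IsTestFunction Ω φ) (hψ : IsTestFunction Ω ψ) :
    IsTestFunction Ω fun x => φ x - ψ x := by
  refine ⟨hφ.contDiff.sub hψ.contDiff, hφ.hasCompactSupport.sub hψ.hasCompactSupport, ?_⟩
  exact (tsupport_sub φ ψ).trans (Set.union_subset hφ.tsupport_subset hψ.tsupport_subset)

theorem gradient_sub (hφ : IsTestFunction Ω φ) (hψ : IsTestFunction Ω ψ) (x : Plane) :
    ∇ (fun y => φ y - ψ y) x = ∇ φ x - ∇ ψ x := by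
  rw [gradient, fderiv_fun_sub (hφ.differentiable x) (hψ.differentiable x), map_sub]
  rfl

theorem integral_smul_gradient (hψ : IsTestFunction Ω ψ) (hφ : IsTestFunction Ω φ) :
    ∫ x, ψ x • ∇ φ x = -∫ x, φ x • ∇ ψ x := by
  have hi : ∀ {f g : Plane → ℝ}, IsTestFunction Ω f → IsTestFunction Ω g →
      Integrable fun x => f x • ∇ g x := fun hf hg =>
    (hf.continuous.smul hg.continuous_gradient).integrable_of_hasCompactSupport
      hf.hasCompactSupport.smul_right
  have hinner : ∀ {f g : Plane → ℝ} (v : Plane), (fun x => inner ℝ v (f x • ∇ g x)) =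
      fun x => f x * fderiv ℝ g x v := fun v => by
    funext x
    rw [inner_smul_right, inner_gradient_eq_fderiv]
  refine ext_inner_left ℝ fun v => ?_
  have h1 := (hi hψ hφ).const_inner (𝕜 := ℝ) v
  have h2 := (hi hφ hψ).const_inner (𝕜 := ℝ) v
  rw [inner_neg_right, ← integral_inner (hi hψ hφ), ← integral_inner (hi hφ hψ)]
  rw [hinner] at h1 h2 ⊢
  rw [hinner, integral_mul_fderiv_eq_neg_fderiv_mul_of_integrable]
  · simp only [mul_comm]
  · simpa only [mul_comm] using h2
  · exact h1
  · exact (hψ.continuous.mul hφ.continuous).integrable_of_hasCompactSupport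
      hψ.hasCompactSupport.mul_right
  · exact fun x _ => hψ.differentiable x
  · exact fun x _ => hφ.differentiable x

/-- Makes Hardy's inequality available for test functions, with the classical gradient. -/
theorem isH10 (hψ : IsTestFunction Ω ψ) : IsH10 Ω ψ (∇ ψ) where
  isH1 :=
    { memLp := (hψ.continuous.memLp_of_hasCompactSupport hψ.hasCompactSupport).restrict Ω
      memLp_grad := (hψ.continuous_gradient.memLp_of_hasCompactSupport
        hψ.hasCompactSupport_gradient).restrict Ω
      hasWeakGradient :=
        { locallyIntegrableOn := hψ.continuous.locallyIntegrable.locallyIntegrableOn Ω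
          locallyIntegrableOn_grad :=
            hψ.continuous_gradient.locallyIntegrable.locallyIntegrableOn Ω
          integral_eq := fun φ hφ => by
            rw [setIntegral_eq_integral_of_forall_compl_eq_zero,
              setIntegral_eq_integral_of_forall_compl_eq_zero, hψ.integral_smul_gradient hφ]
            · exact fun x hx => by rw [hφ.eq_zero_of_notMem hx, zero_smul]
            · exact fun x hx => by rw [hψ.eq_zero_of_notMem hx, zero_smul] } }
  approx := ⟨fun _ => ψ, fun _ => hψ, by simp, by simp⟩

end IsTestFunction

/-! ### From Hardy's inequality to exponential integrability -/

theorem eLpNorm_two_sq_eq_lintegral {α E : Type*} [MeasurableSpace α] [NormedAddCommGroup E]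
    (μ : Measure α) (f : α → E) : eLpNorm f 2 μ ^ 2 = ∫⁻ x, ‖f x‖ₑ ^ 2 ∂μ := by
  have := eLpNorm_nnreal_pow_eq_lintegral (f := f) (μ := μ) (p := 2) two_ne_zero
  simpa using this

theorem lintegral_sq_div_bdryDist_le {Ω : Set Plane} {H : ℝ≥0}
    (hH : ∀ (u : Plane → ℝ) (g : Plane → Plane), IsH10 Ω u g →
      eLpNorm (fun x => u x / bdryDist Ω x) 2 (volume.restrict Ω)
        ≤ (H : ℝ≥0∞) * eLpNorm g 2 (volume.restrict Ω))
    {u : Plane → ℝ} {g : Plane → Plane} (hu : IsH10 Ω u g) :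
    ∫⁻ x in Ω, ‖u x / bdryDist Ω x‖ₑ ^ 2 ≤ H ^ 2 * eLpNorm g 2 (volume.restrict Ω) ^ 2 := by
  rw [← eLpNorm_two_sq_eq_lintegral, ← mul_pow]
  gcongr
  exact hH u g hu

theorem bdryDist_pos {Ω : Set Plane} (hΩ : IsOpen Ω) (hne : (frontier Ω).Nonempty) {x : Plane}
    (hx : x ∈ Ω) : 0 < bdryDist Ω x := by
  refine (isClosed_frontier.notMem_iff_infDist_pos hne).1 fun h => ?_
  rw [hΩ.frontier_eq] at h
  exact h.2 hx

theorem continuous_bdryDist (Ω : Set Plane) : Continuous (bdryDist Ω) :=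
  Metric.continuous_infDist_pt _

/-- Uniform exponential integrability for test functions with small Dirichlet energy. -/
theorem exists_lintegral_exp_sq_div_bdryDist_le {Ω : Set Plane} (hΩ : IsOpen Ω)
    (hne : (frontier Ω).Nonempty) {H : ℝ≥0}
    (hH : ∀ (u : Plane → ℝ) (g : Plane → Plane), IsH10 Ω u g →
      eLpNorm (fun x => u x / bdryDist Ω x) 2 (volume.restrict Ω)
        ≤ (H : ℝ≥0∞) * eLpNorm g 2 (volume.restrict Ω)) :
    ∃ ε M : ℝ≥0∞, 0 < ε ∧ M < ⊤ ∧ ∀ ψ : Plane → ℝ, IsTestFunction Ω ψ →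
      eLpNorm (∇ ψ) 2 (volume.restrict Ω) ^ 2 ≤ ε →
      ∫⁻ x in Ω, ENNReal.ofReal ((Real.exp (2 * ψ x ^ 2) - 1) / bdryDist Ω x ^ 2) ≤ M := by
  obtain ⟨C, hC⟩ := exists_lintegral_sq_le_sq_lintegral_fderiv
  obtain ⟨L, hL⟩ := exists_enorm_deriv_smoothTransition_le
  set q := ENNReal.ofReal (Real.exp (-1)) with hq
  have hq0 : 0 < q := ENNReal.ofReal_pos.2 (Real.exp_pos _)
  have hq1 : q < 1 := by
    rw [hq, ← ENNReal.ofReal_one]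
    exact (ENNReal.ofReal_lt_ofReal_iff one_pos).2 (Real.exp_lt_one_iff.2 (by norm_num))
  set A : ℝ≥0∞ := 4 * C * H ^ 2 with hA
  set B : ℝ≥0∞ := 4 * C * L ^ 2 * (19 : ℕ) with hB
  have hAt : A ≠ ⊤ := by finiteness
  have hBt : B ≠ ⊤ := by finiteness
  set c : ℝ≥0∞ := ENNReal.ofReal (2 * Real.exp 8) + 2 * (1 - q)⁻¹ with hc
  have hct : c < ⊤ := by
    refine ENNReal.add_lt_top.2 ⟨ENNReal.ofReal_lt_top, ENNReal.mul_lt_top (by norm_num) ?_⟩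
    exact ENNReal.inv_lt_top.2 (tsub_pos_of_lt hq1)
  -- The three bounds on the energy make `{1 < |ψ|}` small enough for absorption, make the decay
  -- base at most `exp (-1)`, and keep `M` independent of `ψ`. The `4` in `M` comes from `d ≤ 2 δ`;
  -- the other comparison `δ ≤ d` serves to apply Hardy's inequality.
  refine ⟨min (min A⁻¹ (q * B⁻¹)) 1, 4 * (c * H ^ 2), ?_, ?_, ?_⟩
  · refine lt_min (lt_min (ENNReal.inv_pos.2 hAt) ?_) one_pos
    exact ENNReal.mul_pos hq0.ne' (ENNReal.inv_pos.2 hBt).ne'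
  · refine ENNReal.mul_lt_top (by norm_num) (ENNReal.mul_lt_top hct ?_)
    exact ENNReal.pow_lt_top ENNReal.coe_lt_top
  intro ψ hψ hE
  set E := eLpNorm (∇ ψ) 2 (volume.restrict Ω) ^ 2 with hEdef
  obtain ⟨d, hd, hdδ⟩ := (Metric.lipschitz_infDist_pt (frontier Ω)).exists_isDistanceLike
    (fun _ => Metric.infDist_nonneg) hψ.hasCompactSupport
    fun x hx => bdryDist_pos hΩ hne (hψ.tsupport_subset hx)
  change ∀ x ∈ tsupport ψ, bdryDist Ω x ≤ d x ∧ d x ≤ 2 * bdryDist Ω x at hdδ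
  have hgrad : ∫⁻ x, ‖fderiv ℝ ψ x‖ₑ ^ 2 = E := by
    rw [hEdef, eLpNorm_two_sq_eq_lintegral, ← lintegral_indicator hΩ.measurableSet]
    refine lintegral_congr fun x => ?_
    rw [← enorm_gradient_eq_enorm_fderiv]
    by_cases hx : x ∈ Ω
    · rw [Set.indicator_of_mem hx]
    · rw [Set.indicator_of_notMem hx, hψ.gradient_eq_zero_of_notMem hx]
      simp
  have hX : ∫⁻ x, ‖ψ x‖ₑ ^ 2 ∂quasihyperbolicMeasure d ≤ H ^ 2 * E := by
    refine le_trans ?_ (lintegral_sq_div_bdryDist_le hH hψ.isH10)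
    rw [hd.lintegral_eq, ← lintegral_indicator hΩ.measurableSet]
    refine lintegral_mono fun x => ?_
    by_cases hx : x ∈ tsupport ψ
    · have hxΩ := hψ.tsupport_subset hx
      have hpos := bdryDist_pos hΩ hne hxΩ
      rw [Set.indicator_of_mem hxΩ, ← mul_pow, div_eq_inv_mul, enorm_mul]
      gcongr
      rw [Real.enorm_of_nonneg (inv_nonneg.2 (hd.pos x).le),
        Real.enorm_of_nonneg (inv_nonneg.2 hpos.le)]
      exact ENNReal.ofReal_le_ofReal (inv_anti₀ hpos (hdδ x hx).1)
    · simp [image_eq_zero_of_notMem_tsupport hx]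
  have hexp := hd.lintegral_exp_sq_le hC hL hψ.contDiff_one hψ.hasCompactSupport
    (by
      calc _ ≤ 4 * C * (H ^ 2 * A⁻¹) := by
            gcongr
            exact hX.trans (by gcongr; exact hE.trans ((min_le_left _ _).trans (min_le_left _ _)))
        _ = A * A⁻¹ := by rw [hA]; ring
        _ ≤ 1 := ENNReal.mul_inv_le_one A)
    (by
      rw [hgrad]
      calc B * E ≤ B * (q * B⁻¹) := by
            gcongr
            exact hE.trans ((min_le_left _ _).trans (min_le_right _ _))
        _ = q * (B * B⁻¹) := by ring
        _ ≤ q * 1 := by gcongr; exact ENNReal.mul_inv_le_one B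
        _ = q := mul_one q)
  have hm : Measurable fun x => ‖(d x)⁻¹‖ₑ ^ 2 * ENNReal.ofReal (Real.exp (2 * ψ x ^ 2) - 1) := by
    have := hd.measurable_enorm_inv
    have := hψ.continuous.measurable
    fun_prop
  calc ∫⁻ x in Ω, ENNReal.ofReal ((Real.exp (2 * ψ x ^ 2) - 1) / bdryDist Ω x ^ 2)
      ≤ ∫⁻ x, ENNReal.ofReal ((Real.exp (2 * ψ x ^ 2) - 1) / bdryDist Ω x ^ 2) :=
        setLIntegral_le_lintegral _ _
    _ ≤ ∫⁻ x, 4 * (‖(d x)⁻¹‖ₑ ^ 2 * ENNReal.ofReal (Real.exp (2 * ψ x ^ 2) - 1)) := by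
        refine lintegral_mono fun x => ?_
        by_cases hx : x ∈ tsupport ψ
        · have hpos := bdryDist_pos hΩ hne (hψ.tsupport_subset hx)
          have hdpos := hd.pos x
          have h0 : 0 ≤ Real.exp (2 * ψ x ^ 2) - 1 :=
            sub_nonneg.2 (Real.one_le_exp (by positivity))
          rw [Real.enorm_of_nonneg (inv_nonneg.2 hdpos.le), ← ENNReal.ofReal_pow (by positivity),
            ← ENNReal.ofReal_mul (by positivity), ← ENNReal.ofReal_ofNat,
            ← ENNReal.ofReal_mul (by positivity)]
          refine ENNReal.ofReal_le_ofReal ?_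
          rw [div_eq_mul_inv, mul_comm, ← mul_assoc]
          refine mul_le_mul_of_nonneg_right ?_ h0
          rw [inv_pow, ← div_eq_mul_inv, ← one_div, div_le_div_iff₀ (by positivity) (by positivity)]
          nlinarith [(hdδ x hx).2]
        · simp [image_eq_zero_of_notMem_tsupport hx]
    _ ≤ 4 * (c * H ^ 2) := by
        rw [lintegral_const_mul _ hm, ← hd.lintegral_eq]
        gcongr
        refine hexp.trans ?_
        gcongr
        calc _ ≤ (H : ℝ≥0∞) ^ 2 * E := hX
          _ ≤ H ^ 2 * 1 := by gcongr; exact hE.trans (min_le_right _ _)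
          _ = _ := mul_one _

theorem IsH10.integrableOn_sq_div_bdryDist {Ω : Set Plane} {H : ℝ≥0}
    (hH : ∀ (u : Plane → ℝ) (g : Plane → Plane), IsH10 Ω u g →
      eLpNorm (fun x => u x / bdryDist Ω x) 2 (volume.restrict Ω)
        ≤ (H : ℝ≥0∞) * eLpNorm g 2 (volume.restrict Ω))
    {u : Plane → ℝ} {g : Plane → Plane} (hu : IsH10 Ω u g) :
    IntegrableOn (fun x => u x ^ 2 / bdryDist Ω x ^ 2) Ω := by
  have hm : MemLp (fun x => u x / bdryDist Ω x) 2 (volume.restrict Ω) :=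
    ⟨(hu.isH1.memLp.1.aemeasurable.div
      (continuous_bdryDist Ω).measurable.aemeasurable).aestronglyMeasurable,
      (hH u g hu).trans_lt (ENNReal.mul_lt_top ENNReal.coe_lt_top hu.isH1.memLp_grad.2)⟩
  simpa only [div_pow, IntegrableOn] using hm.integrable_sq

/-- A function in `H₀¹` differs from a test function by a function whose square is
exponentially integrable. -/
theorem IsH10.exists_isTestFunction_lintegral_exp_lt_top {Ω : Set Plane} (hΩ : IsOpen Ω)
    (hne : (frontier Ω).Nonempty) {H : ℝ≥0}
    (hH : ∀ (u : Plane → ℝ) (g : Plane → Plane), IsH10 Ω u g →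
      eLpNorm (fun x => u x / bdryDist Ω x) 2 (volume.restrict Ω)
        ≤ (H : ℝ≥0∞) * eLpNorm g 2 (volume.restrict Ω))
    {u : Plane → ℝ} {g : Plane → Plane} (hu : IsH10 Ω u g) :
    ∃ φ, IsTestFunction Ω φ ∧
      ∫⁻ x in Ω, ENNReal.ofReal ((Real.exp (2 * (u x - φ x) ^ 2) - 1) / bdryDist Ω x ^ 2) < ⊤ := by
  obtain ⟨ε, M, hε, hM, hbound⟩ := exists_lintegral_exp_sq_div_bdryDist_le hΩ hne hH
  obtain ⟨φ, hφ, hφu, hφg⟩ := hu.approx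
  set μ := volume.restrict Ω with hμ
  -- The cap at `1` gives `η² ≤ η ≤ ε`.
  set η := min 1 ε with hη
  have hη0 : 0 < η := lt_min one_pos hε
  have hev : ∀ᶠ n in atTop, eLpNorm (fun x => g x - ∇ (φ n) x) 2 μ < η / 2 :=
    hφg.eventually_lt_const (ENNReal.half_pos hη0.ne')
  obtain ⟨N, hN⟩ := eventually_atTop.1 hev
  have hgm : AEStronglyMeasurable g μ := hu.isH1.memLp_grad.1
  have hum : AEStronglyMeasurable u μ := hu.isH1.memLp.1
  have hsmall : ∀ n ≥ N, eLpNorm (∇ fun x => φ n x - φ N x) 2 μ ^ 2 ≤ ε := by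
    intro n hn
    have heq : (∇ fun x => φ n x - φ N x) =
        (fun x => g x - ∇ (φ N) x) - fun x => g x - ∇ (φ n) x := by
      funext x
      rw [(hφ n).gradient_sub (hφ N), Pi.sub_apply, sub_sub_sub_cancel_left]
    have hle : eLpNorm (∇ fun x => φ n x - φ N x) 2 μ ≤ η := by
      rw [heq]
      refine (eLpNorm_sub_le (hgm.sub (hφ N).continuous_gradient.aestronglyMeasurable)
        (hgm.sub (hφ n).continuous_gradient.aestronglyMeasurable) one_le_two).trans ?_
      exact (add_le_add (hN N le_rfl).le (hN n hn).le).trans_eq (ENNReal.add_halves η)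
    calc _ ≤ η ^ 2 := by gcongr
      _ ≤ η := pow_le_of_le_one zero_le (min_le_left _ _) two_ne_zero
      _ ≤ ε := min_le_right _ _
  -- An almost everywhere convergent subsequence, to which Fatou's lemma applies with the uniform
  -- bound for `φ n - φ N`.
  have hmeas : TendstoInMeasure μ φ atTop u := by
    refine tendstoInMeasure_of_tendsto_eLpNorm two_ne_zero
      (fun n => (hφ n).continuous.aestronglyMeasurable) hum ?_
    refine hφu.congr fun n => ?_
    exact eLpNorm_sub_comm u (φ n) 2 μ
  obtain ⟨ns, hns, hae⟩ := hmeas.exists_seq_tendsto_ae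
  refine ⟨φ N, hφ N, lt_of_le_of_lt ?_ hM⟩
  set F : ℕ → Plane → ℝ≥0∞ := fun k x => ENNReal.ofReal
    ((Real.exp (2 * (φ (ns k) x - φ N x) ^ 2) - 1) / bdryDist Ω x ^ 2) with hF
  have hFm : ∀ k, Measurable (F k) := fun k => by
    have h1 := (hφ (ns k)).continuous.measurable
    have h2 := (hφ N).continuous.measurable
    have h3 := (continuous_bdryDist Ω).measurable
    fun_prop
  calc _ ≤ ∫⁻ x, liminf (fun k => F k x) atTop ∂μ := by
        refine lintegral_mono_ae ?_
        filter_upwards [hae] with x hx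
        refine (Tendsto.liminf_eq ?_).ge
        refine ENNReal.tendsto_ofReal (Tendsto.div_const (Tendsto.sub_const ?_ _) _)
        exact (Real.continuous_exp.tendsto _).comp (((hx.sub_const _).pow 2).const_mul 2)
    _ ≤ liminf (fun k => ∫⁻ x, F k x ∂μ) atTop := lintegral_liminf_le hFm
    _ ≤ M := by
        refine liminf_le_of_frequently_le' (Eventually.frequently ?_)
        filter_upwards [hns.tendsto_atTop.eventually_ge_atTop N] with k hk
        exact hbound _ ((hφ (ns k)).sub (hφ N)) (hsmall (ns k) hk)

theorem IsH10.integrableOn_exp_sq_div_bdryDist {Ω : Set Plane} (hΩ : IsOpen Ω)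
    (hne : (frontier Ω).Nonempty) {H : ℝ≥0}
    (hH : ∀ (u : Plane → ℝ) (g : Plane → Plane), IsH10 Ω u g →
      eLpNorm (fun x => u x / bdryDist Ω x) 2 (volume.restrict Ω)
        ≤ (H : ℝ≥0∞) * eLpNorm g 2 (volume.restrict Ω))
    {u : Plane → ℝ} {g : Plane → Plane} (hu : IsH10 Ω u g) :
    IntegrableOn (fun x => (Real.exp (u x ^ 2) - 1) / bdryDist Ω x ^ 2) Ω := by
  obtain ⟨φ, hφ, hfin⟩ := hu.exists_isTestFunction_lintegral_exp_lt_top hΩ hne hH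
  have hum : AEMeasurable u (volume.restrict Ω) := hu.isH1.memLp.1.aemeasurable
  have hφm : Measurable φ := hφ.continuous.measurable
  have hδm : Measurable (bdryDist Ω) := (continuous_bdryDist Ω).measurable
  obtain ⟨b, hb⟩ := hφ.hasCompactSupport.exists_bound_of_continuous hφ.continuous
  have hexp0 : ∀ t : ℝ, 0 ≤ t → 0 ≤ Real.exp t - 1 := fun t ht =>
    sub_nonneg.2 (Real.one_le_exp ht)
  have hr : IntegrableOn
      (fun x => (Real.exp (2 * (u x - φ x) ^ 2) - 1) / bdryDist Ω x ^ 2) Ω := by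
    refine ⟨AEMeasurable.aestronglyMeasurable (by fun_prop), ?_⟩
    rw [hasFiniteIntegral_iff_ofReal (ae_of_all _ fun x => ?_)]
    · exact hfin
    · exact div_nonneg (hexp0 _ (by positivity)) (sq_nonneg _)
  have hs := hφ.isH10.integrableOn_sq_div_bdryDist hH
  refine Integrable.mono' ((hr.const_mul (Real.exp (2 * b ^ 2))).add
    (hs.const_mul (2 * Real.exp (2 * b ^ 2))))
    (AEMeasurable.aestronglyMeasurable (by fun_prop)) (ae_of_all _ fun x => ?_)
  rw [Real.norm_of_nonneg (div_nonneg (hexp0 _ (sq_nonneg _)) (sq_nonneg _)), Pi.add_apply,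
    ← mul_div_assoc, ← mul_div_assoc, ← add_div]
  refine div_le_div_of_nonneg_right ?_ (sq_nonneg _)
  set r := u x - φ x with hrdef
  -- The difference of the two sides is `(u - 2φ)²`.
  have hsq : u x ^ 2 ≤ 2 * φ x ^ 2 + 2 * r ^ 2 := by nlinarith [sq_nonneg (u x - 2 * φ x)]
  have hφb : φ x ^ 2 ≤ b ^ 2 := sq_le_sq' (neg_le_of_abs_le (hb x)) (le_of_abs_le (hb x))
  have hE : Real.exp (2 * φ x ^ 2) ≤ Real.exp (2 * b ^ 2) := Real.exp_le_exp.2 (by linarith)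
  have hlin : Real.exp (2 * φ x ^ 2) - 1 ≤ 2 * φ x ^ 2 * Real.exp (2 * φ x ^ 2) := by
    have h1 := mul_le_mul_of_nonneg_left (Real.one_sub_le_exp_neg (2 * φ x ^ 2))
      (Real.exp_pos (2 * φ x ^ 2)).le
    rw [← Real.exp_add, add_neg_cancel, Real.exp_zero] at h1
    linarith
  calc Real.exp (u x ^ 2) - 1 ≤ Real.exp (2 * φ x ^ 2 + 2 * r ^ 2) - 1 :=
        sub_le_sub_right (Real.exp_le_exp.2 hsq) 1
    _ = Real.exp (2 * φ x ^ 2) * (Real.exp (2 * r ^ 2) - 1) + (Real.exp (2 * φ x ^ 2) - 1) := by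
        rw [Real.exp_add]; ring
    _ ≤ Real.exp (2 * b ^ 2) * (Real.exp (2 * r ^ 2) - 1) +
        2 * φ x ^ 2 * Real.exp (2 * b ^ 2) := by
        have := hexp0 (2 * r ^ 2) (by positivity)
        gcongr
        exact hlin.trans (by gcongr)
    _ = _ := by ring

/-! ### Conclusion -/

theorem theorem1 (Ω : Set Plane) (hΩ_open : IsOpen Ω) (hΩ_conn : IsConnected Ω)
    (hHardy : HardyInequality Ω) (u : Plane → ℝ) (hu : MemH10 Ω u) :
    IntegrableOn (fun x => (Real.exp (u x ^ 2) - 1) / bdryDist Ω x ^ 2) Ω volume ∧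
    IntegrableOn (fun x => u x ^ 2 / bdryDist Ω x ^ 2) Ω volume ∧
    (Bornology.IsBounded Ω →
      IntegrableOn (fun x => Real.exp (u x ^ 2) - 1) Ω volume) := by
  obtain ⟨H, hH⟩ := hHardy
  obtain ⟨g, hg⟩ := hu
  rcases (frontier Ω).eq_empty_or_nonempty with hemp | hne
  -- Without boundary the quotients are `0` by division by zero. A nonempty clopen `Ω` is the whole
  -- plane, so it is not bounded.
  · have hδ : ∀ x, bdryDist Ω x = 0 := fun x => by rw [bdryDist, hemp, Metric.infDist_empty]
    refine ⟨by simp [hδ], by simp [hδ], fun hb => ?_⟩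
    rcases isClopen_iff.1 (isClopen_iff_frontier_eq_empty.2 hemp) with h | h
    · exact absurd h hΩ_conn.nonempty.ne_empty
    · exact absurd (h ▸ hb) (NormedSpace.unbounded_univ ℝ Plane)
  have hmain := hg.integrableOn_exp_sq_div_bdryDist hΩ_open hne hH
  refine ⟨hmain, hg.integrableOn_sq_div_bdryDist hH, fun hb => ?_⟩
  obtain ⟨y, hy⟩ := hne
  have hum : AEMeasurable u (volume.restrict Ω) := hg.isH1.memLp.1.aemeasurable
  -- On a bounded `Ω`, `δ` is at most the diameter, so the weight `δ⁻²` is bounded below.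
  refine Integrable.mono' (hmain.const_mul (Metric.diam (closure Ω) ^ 2))
    (AEMeasurable.aestronglyMeasurable (by fun_prop))
    (ae_restrict_of_forall_mem hΩ_open.measurableSet fun x hx => ?_)
  have hpos := bdryDist_pos hΩ_open ⟨y, hy⟩ hx
  have hle : bdryDist Ω x ≤ Metric.diam (closure Ω) :=
    (Metric.infDist_le_dist_of_mem hy).trans
      (Metric.dist_le_diam_of_mem hb.closure (subset_closure hx) (frontier_subset_closure hy))
  have h0 : 0 ≤ Real.exp (u x ^ 2) - 1 := sub_nonneg.2 (Real.one_le_exp (sq_nonneg _))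
  rw [Real.norm_of_nonneg h0, ← mul_div_assoc, le_div_iff₀ (by positivity), mul_comm]
  gcongr
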